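/- Let $G=(V,E)$ be a finite, simple, connected graph (with at least one vertex), and let $\mathcal A=\{(u,v),(v,u) : uv\in E\}$ be its set of arcs. An arc $e=(u,v)$ has origin $o(e)=u$, terminus $t(e)=v$ and inverse arc $\bar e=(v,u)$. The time evolution of the Grover walk on $G$ is the complex matrix $U=(U_{e,f})_{e,f\in\mathcal A}$ given by $$U_{e,f}=\begin{cases}2/\deg t(f) & \text{if } t(f)=o(e),\ e\neq\bar f,\\ 2/\deg t(f)-1 & \text{if } e=\bar f,\\ 0&\text{otherwise.}\end{cases}$$ For a positive integer $k$, the graph $G$ is called $k$-periodic if $k$ is the least positive integer $m$ with $U^m=I$. For $k\ge 3$ let $C_k$ be the cycle graph on $k$ vertices; in the degenerate case $k=1$ let $C_1$ be the graph with one vertex and no edges (it has no arcs, so that $U$ is the empty matrix and the graph is $1$-periodic). Then for every odd positive integer $k$, the graph $G$ is $k$-periodic if and only if $G$ is isomorphic to $C_k$. Consequently, $G$ is $k$-periodic for some odd $k$ if and only if $G$ is isomorphic to $C_k$ for some odd $k$. -/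

import Mathlib

namespace GroverWalk

variable {V : Type*} [Fintype V] [DecidableEq V] (G : SimpleGraph V) [DecidableRel G.Adj]

/-- The time evolution matrix `U` of the Grover walk on `G`, indexed by the arcs of `G`
(`SimpleGraph.Dart`: ordered pairs of adjacent vertices). The origin of an arc `e` is `e.fst`, its
terminus is `e.snd`, and its inverse arc is `e.symm`. -/
noncomputable def timeEvolution : Matrix G.Dart G.Dart ℂ :=
  Matrix.of fun e f =>
    if f.snd = e.fst ∧ e ≠ f.symm then 2 / (G.degree f.snd : ℂ)
    else if e = f.symm then 2 / (G.degree f.snd : ℂ) - 1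
    else 0

/-- `G` is `k`-periodic: the Grover walk on `G` is periodic and its period, the least positive
integer `m` with `U ^ m = I`, is `k`. -/
def IsKPeriodic (k : ℕ) : Prop :=
  IsLeast {m : ℕ | 0 < m ∧ timeEvolution G ^ m = 1} k

end GroverWalk

/-!
Write `A` and `D` for the adjacency and degree matrices, `n` for the number of vertices, `S` for the
arc reversal and `U` for the time evolution. The entries of `U` are rational, so the argument runs
over `ℚ`. Suppose that `U ^ k = 1` with `k` odd and that `G` has at least two vertices.

*The number of arcs is `2n`.* The matrix `S U = 2 KᵀD⁻¹K - 1` (`K` being the incidence of arcs with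
their termini) is an involution, and so is `S`. As `U = S (S U)` has odd order, the two involutions
are conjugate in the dihedral group they generate. Comparing traces, `2n - |arcs| = tr (S U) = tr S = 0`
(`card_dart_eq_of_pow_eq_one`).

*The characteristic polynomial.* A Schur complement computation gives in that case
`det D * χ(X) = det ((X² + 1) D - 2 X A)` for the characteristic polynomial `χ` of `U`
(`det_charpoly_eq`). Adding up the rows of the matrix on the right shows that `χ` vanishes at `1` to
order at most two, because the Laplacian of a connected graph has corank one
(`rootMultiplicity_charpoly_le`).

*The value at `-1`.* Since `χ` divides a power of `X ^ k - 1`, it is an integer polynomial, and its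
cofactor to the power of `X - 1` it contains divides a power of `1 + X + ⋯ + X ^ (k - 1)`, whose value
at `-1` is `1`. So `|χ(-1)|` is `1`, `2` or `4` (`abs_eval_neg_one_of_dvd`). On the other hand
`∏ deg v * χ(-1) = 2 ^ n * det (D + A)`, and `det (D + A)` is a nonzero multiple of `4`
(`four_dvd_det_signless`). Hence `∏ deg v ≥ 2 ^ n`, while `∑ deg v = 2n`; the equality case of the
inequality of the means, here in the form `d ≤ 2 ^ (d - 1)`, makes every degree equal to two.

A connected graph with all degrees two is a cycle (`nonempty_iso_cycleGraph`), and on the cycle with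
`m ≥ 3` vertices the walk rotates every arc in its own direction, hence has period exactly `m`
(`isKPeriodic_cycleGraph`).
-/

namespace GroverWalk

section Spectrum

open Polynomial Matrix

/-! ### Characteristic polynomials of matrices of finite order -/

/-- Take determinants in `X ^ k - M ^ k = (X - M) Q`. -/
theorem charpoly_dvd_of_pow_eq_one {n R : Type*} [Fintype n] [DecidableEq n] [CommRing R]
    (M : Matrix n n R) {k : ℕ} (h : M ^ k = 1) :
    M.charpoly ∣ (X ^ k - 1) ^ Fintype.card n := by
  have h1 : charmatrix M ∣ (scalar n (X : R[X])) ^ k - (C.mapMatrix M) ^ k :=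
    (scalar_commute _ (fun r => Commute.all _ r) _).sub_dvd_pow_sub_pow k
  obtain ⟨Q, hQ⟩ := h1
  refine ⟨Q.det, ?_⟩
  rw [Matrix.charpoly, ← det_mul, ← hQ, ← map_pow, ← map_pow, h, map_one,
    ← map_one (scalar n), ← map_sub]
  simp [scalar_apply, det_diagonal]

/-- For odd `k`, only the factor `X - 1` of `X ^ k - 1` contributes to the value at `-1`: the geometric
sum `1 + X + ⋯ + X ^ (k - 1)` takes the value `1` there, so every divisor of its powers takes a unit
value. -/
theorem abs_eval_neg_one_of_dvd {p : ℤ[X]} {k N : ℕ} (hk : Odd k)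
    (h : p ∣ (X ^ k - 1) ^ N) : |p.eval (-1)| = 2 ^ p.rootMultiplicity 1 := by
  have hk0 : k ≠ 0 := fun h0 => by simp [h0] at hk
  have hp : p ≠ 0 := by
    rintro rfl
    exact pow_ne_zero N (X_pow_sub_C_ne_zero (Nat.pos_of_ne_zero hk0) (1 : ℤ)) (by simpa using h)
  obtain ⟨q, hq, hnd⟩ := exists_eq_pow_rootMultiplicity_mul_and_not_dvd p hp 1
  have hrel : IsRelPrime q ((X - C 1) ^ N) :=
    (((irreducible_X_sub_C (1 : ℤ)).isRelPrime_iff_not_dvd.2 hnd).symm).pow_right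
  have hfac : (X ^ k - 1 : ℤ[X]) ^ N = (X - C 1) ^ N * (∑ i ∈ Finset.range k, X ^ i) ^ N := by
    rw [← mul_pow, C_1, mul_comm, geom_sum_mul]
  have hdvd : q ∣ (∑ i ∈ Finset.range k, X ^ i) ^ N := by
    refine hrel.dvd_of_dvd_mul_left ?_
    rw [← hfac]
    exact (Dvd.intro_left _ hq.symm).trans h
  have hunit : IsUnit (q.eval (-1)) := by
    have h2 := eval_dvd (x := (-1 : ℤ)) hdvd
    have h3 : ((∑ i ∈ Finset.range k, (X : ℤ[X]) ^ i) ^ N).eval (-1) = 1 := by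
      rw [eval_pow, eval_finsetSum]
      simp [neg_one_geom_sum, Nat.not_even_iff_odd.2 hk]
    rw [h3] at h2
    exact isUnit_of_dvd_one h2
  conv_lhs => rw [hq]
  rw [eval_mul, abs_mul, Int.isUnit_iff_abs_eq.1 hunit, eval_pow, abs_pow]
  norm_num

/-- Gauss's lemma: the characteristic polynomial of a rational matrix of finite order is integral. -/
theorem exists_int_charpoly_dvd {n : Type*} [Fintype n] [DecidableEq n]
    (M : Matrix n n ℚ) {k : ℕ} (hk : k ≠ 0) (h : M ^ k = 1) :
    ∃ p : ℤ[X], p.map (Int.castRingHom ℚ) = M.charpoly ∧ p ∣ (X ^ k - 1) ^ Fintype.card n := by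
  have hf : ((X ^ k - 1 : ℤ[X]) ^ Fintype.card n).Monic :=
    (by simpa using monic_X_pow_sub_C (1 : ℤ) hk : (X ^ k - 1 : ℤ[X]).Monic).pow _
  have hd := charpoly_dvd_of_pow_eq_one M h
  obtain ⟨p, hp⟩ := IsIntegrallyClosed.eq_map_mul_C_of_dvd ℚ hf (g := M.charpoly) (by simpa using hd)
  rw [M.charpoly_monic.leadingCoeff, C_1, mul_one] at hp
  have hp' : p.map (Int.castRingHom ℚ) = M.charpoly := hp
  have hm : p.Monic := by
    refine monic_of_injective (f := Int.castRingHom ℚ) Int.cast_injective ?_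
    rw [hp']; exact M.charpoly_monic
  refine ⟨p, hp', (map_dvd_map (Int.castRingHom ℚ) Int.cast_injective hm).1 ?_⟩
  rw [hp']; simpa using hd

/-! ### Determinant identities -/

/-- For an involution `S`, the inverse of `z + S` is `(z - S) / (z² - 1)`; this is the resulting Schur
complement formula with denominators cleared. The factor `D` clears those of `B`. -/
theorem det_mul_det_sub_mul_mul_pow {m n R : Type*} [Fintype m] [DecidableEq m] [Fintype n]
    [DecidableEq n] [CommRing R] (z : R) (S : Matrix m m R) (hS : S * S = 1) (O : Matrix m n R)
    (B K : Matrix n m R) (D : Matrix n n R) (hB : D * B = K) :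
    D.det * (z • 1 + S - O * B).det * (z ^ 2 - 1) ^ Fintype.card n =
      (z • 1 + S).det * ((z ^ 2 - 1) • D - K * (z • 1 - S) * O).det := by
  have h1 : fromBlocks 1 0 (-(B * (z • 1 - S))) ((z ^ 2 - 1) • (1 : Matrix n n R)) *
      fromBlocks (z • 1 + S) O B 1 =
      fromBlocks (z • 1 + S) O 0 ((z ^ 2 - 1) • 1 - B * (z • 1 - S) * O) := by
    have hz : (z • 1 - S) * (z • 1 + S) = (z ^ 2 - 1) • (1 : Matrix m m R) := by
      simp only [sub_mul, mul_add, hS, Matrix.smul_mul, Matrix.mul_smul, one_mul, mul_one,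
        smul_smul, sub_smul, one_smul, pow_two]
      abel
    rw [fromBlocks_multiply]
    congr 1
    · simp
    · simp
    · rw [Matrix.neg_mul, Matrix.mul_assoc, hz]
      simp
    · rw [Matrix.neg_mul]
      simp [sub_eq_neg_add]
  have h2 := congrArg det h1
  rw [det_mul, det_fromBlocks_zero₁₂, det_fromBlocks_zero₂₁, det_fromBlocks_one₂₂] at h2
  simp only [det_one, one_mul, det_smul, mul_one] at h2
  have h3 : (z ^ 2 - 1) • D - K * (z • 1 - S) * O =
      D * ((z ^ 2 - 1) • 1 - B * (z • 1 - S) * O) := by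
    rw [← hB, Matrix.mul_sub D ((z ^ 2 - 1) • 1), Matrix.mul_smul, Matrix.mul_one]
    simp only [Matrix.mul_assoc]
  rw [h3, det_mul]
  linear_combination D.det * h2

theorem det_eq_mul_det_updateRow {n R : Type*} [Fintype n] [DecidableEq n] [CommRing R]
    (A : Matrix n n R) (i : n) (a : R) (u : n → R) (h : ∀ j, ∑ k, A k j = a * u j) :
    A.det = a * (A.updateRow i u).det := by
  have hrow : (∑ k, (1 : R) • A k) = a • u := by
    ext j
    have hj : (∑ k, (1 : R) • A k) j = ∑ k, ((1 : R) • A k) j := Finset.sum_apply j _ _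
    rw [hj]
    simpa using h j
  have hdet := det_updateRow_sum A i (fun _ => 1)
  rw [hrow, det_updateRow_smul, one_smul] at hdet
  exact hdet.symm

/-! ### A product bound for positive integers of average two -/

/-- Equality case of the inequality of arithmetic and geometric means for positive integers of
average two. -/
theorem all_eq_two_of_prod {ι : Type*} [Fintype ι] (d : ι → ℕ) (hpos : ∀ i, 0 < d i)
    (hsum : ∑ i, d i = 2 * Fintype.card ι) (hprod : 2 ^ Fintype.card ι ≤ ∏ i, d i) (i : ι) :
    d i = 2 := by
  have hle : ∀ i, d i ≤ 2 ^ (d i - 1) := fun i => by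
    have := Nat.lt_two_pow_self (n := d i - 1)
    have := hpos i
    omega
  have hs : ∑ i, (d i - 1) = Fintype.card ι := by
    have : ∑ i, (d i - 1) + ∑ _i : ι, 1 = ∑ i, d i := by
      rw [← Finset.sum_add_distrib]
      exact Finset.sum_congr rfl fun i _ => Nat.sub_add_cancel (hpos i)
    simp only [Finset.sum_const, Finset.card_univ, smul_eq_mul, mul_one] at this
    omega
  have hle2 : ∀ j, d j ≤ 2 := by
    by_contra! hcon
    obtain ⟨j, hj⟩ := hcon
    have hlt : d j < 2 ^ (d j - 1) := by
      obtain ⟨t, ht⟩ : ∃ t, d j = t + 3 := ⟨d j - 3, by omega⟩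
      have := Nat.lt_two_pow_self (n := t)
      rw [ht, show t + 3 - 1 = t + 2 by omega, pow_add]
      omega
    have := Finset.prod_lt_prod (fun i _ => hpos i) (fun i _ => hle i) ⟨j, Finset.mem_univ j, hlt⟩
    rw [Finset.prod_pow_eq_pow_sum, hs] at this
    omega
  have := (Finset.sum_eq_sum_iff_of_le (s := Finset.univ) (f := d) (g := fun _ => 2)
    (fun i _ => hle2 i)).1 (by simp [hsum, mul_comm])
  exact this i (Finset.mem_univ i)

/-! ### Incidence matrices of the arcs -/

section Incidence

variable {V : Type*} [Fintype V] [DecidableEq V] (G : SimpleGraph V) [DecidableRel G.Adj]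

/-- The permutation matrix of the involution `e ↦ e.symm` on arcs. -/
def arcReversal (R : Type*) [Zero R] [One R] : Matrix G.Dart G.Dart R :=
  of fun e f => if e = f.symm then 1 else 0

/-- The 0-1 matrix with entry `1` at `(e, v)` when the arc `e` starts at `v`. -/
def originMatrix (R : Type*) [Zero R] [One R] : Matrix G.Dart V R :=
  of fun e v => if e.fst = v then 1 else 0

/-- The 0-1 matrix with entry `1` at `(v, f)` when the arc `f` ends at `v`. -/
def terminusMatrix (R : Type*) [Zero R] [One R] : Matrix V G.Dart R :=
  of fun v f => if f.snd = v then 1 else 0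

/-- The matrix `D⁻¹ K` that averages a function on arcs over the arcs ending at each vertex, where `D`
is the degree matrix and `K` is `terminusMatrix`. -/
noncomputable def averagingMatrix : Matrix V G.Dart ℚ :=
  of fun v f => if f.snd = v then (G.degree v : ℚ)⁻¹ else 0

/-- The time evolution of the Grover walk with entries in `ℚ`, written as twice the averaging followed
by distribution along outgoing arcs, minus the arc reversal. -/
noncomputable def rationalEvolution : Matrix G.Dart G.Dart ℚ :=
  (2 : ℚ) • (originMatrix G ℚ * averagingMatrix G) - arcReversal G ℚ

theorem arcReversal_mul_self (R : Type*) [CommRing R] :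
    arcReversal G R * arcReversal G R = 1 := by
  ext e f
  simp [arcReversal, Matrix.mul_apply, Matrix.one_apply]

theorem arcReversal_mul_originMatrix (R : Type*) [CommRing R] :
    arcReversal G R * originMatrix G R = (terminusMatrix G R)ᵀ := by
  ext e v
  have h : ∀ f : G.Dart, e = f.symm ↔ e.symm = f := fun f =>
    ⟨fun h => by simp [h], fun h => by simp [← h]⟩
  simp only [arcReversal, originMatrix, terminusMatrix, Matrix.mul_apply, of_apply, h, ite_mul,
    one_mul, zero_mul, Finset.sum_ite_eq, Finset.mem_univ, if_true, transpose_apply,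
    SimpleGraph.Dart.symm_toProd, Prod.fst_swap]

theorem terminusMatrix_mul_originMatrix (R : Type*) [CommRing R] :
    terminusMatrix G R * originMatrix G R = G.adjMatrix R := by
  ext v w
  simp only [terminusMatrix, originMatrix, Matrix.mul_apply, of_apply, SimpleGraph.adjMatrix_apply,
    mul_ite, mul_one, mul_zero, ← ite_and]
  split_ifs with h
  · rw [Finset.sum_eq_single ⟨(w, v), h.symm⟩]
    · simp
    · intro e _ he
      rw [if_neg]
      rintro ⟨h1, h2⟩
      exact he (SimpleGraph.Dart.ext _ _ (Prod.ext h1 h2))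
    · simp
  · refine Finset.sum_eq_zero fun e _ => if_neg ?_
    rintro ⟨rfl, rfl⟩
    exact h e.adj.symm

theorem card_filter_snd (v : V) :
    (Finset.univ.filter fun e : G.Dart => e.snd = v).card = G.degree v := by
  rw [← G.dart_fst_fiber_card_eq_degree v]
  refine Finset.card_bij' (fun e _ => e.symm) (fun e _ => e.symm) ?_ ?_ ?_ ?_ <;> simp

theorem terminusMatrix_mul_transpose (R : Type*) [CommRing R] :
    terminusMatrix G R * (terminusMatrix G R)ᵀ = G.degMatrix R := by
  ext v w
  simp only [terminusMatrix, SimpleGraph.degMatrix, Matrix.mul_apply, of_apply, transpose_apply,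
    mul_ite, mul_one, mul_zero, ← ite_and, diagonal_apply]
  split_ifs with h
  · subst h
    simp [← card_filter_snd]
  · refine Finset.sum_eq_zero fun e _ => if_neg ?_
    rintro ⟨rfl, rfl⟩
    exact h rfl

theorem degMatrix_mul_averagingMatrix :
    G.degMatrix ℚ * averagingMatrix G = terminusMatrix G ℚ := by
  ext v e
  simp only [SimpleGraph.degMatrix, diagonal_mul, averagingMatrix, terminusMatrix, of_apply]
  split_ifs with h
  · subst h
    exact mul_inv_cancel₀ (Nat.cast_ne_zero.2 e.adj.degree_pos_right.ne')
  · simp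

theorem averagingMatrix_mul_transpose (hpos : ∀ v, 0 < G.degree v) :
    averagingMatrix G * (terminusMatrix G ℚ)ᵀ = 1 := by
  have h : averagingMatrix G = diagonal (fun v => (G.degree v : ℚ)⁻¹) * terminusMatrix G ℚ := by
    ext v e
    simp [averagingMatrix, terminusMatrix]
  rw [h, Matrix.mul_assoc, terminusMatrix_mul_transpose, SimpleGraph.degMatrix,
    diagonal_mul_diagonal, ← diagonal_one]
  congr 1
  ext v
  exact inv_mul_cancel₀ (Nat.cast_ne_zero.2 (hpos v).ne')

theorem rationalEvolution_apply (e f : G.Dart) : rationalEvolution G e f =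
    2 * (if f.snd = e.fst then (G.degree f.snd : ℚ)⁻¹ else 0) - if e = f.symm then 1 else 0 := by
  simp only [rationalEvolution, originMatrix, averagingMatrix, arcReversal, Matrix.sub_apply,
    Matrix.smul_apply, Matrix.mul_apply, of_apply, ite_mul, one_mul, zero_mul, Finset.sum_ite_eq, Finset.mem_univ,
    if_true, smul_eq_mul]
  congr 2
  split_ifs with h
  · rw [h]
  · rfl

theorem timeEvolution_eq_map :
    timeEvolution G = (algebraMap ℚ ℂ).mapMatrix (rationalEvolution G) := by
  ext e f
  rw [RingHom.mapMatrix_apply, map_apply, rationalEvolution_apply]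
  by_cases h : e = f.symm
  · subst h
    simp [timeEvolution, div_eq_mul_inv]
  · simp only [timeEvolution, of_apply, h, ne_eq, not_false_eq_true, and_true, if_false, sub_zero]
    split_ifs <;> simp [div_eq_mul_inv]

theorem timeEvolution_pow_eq_one_iff (m : ℕ) :
    timeEvolution G ^ m = 1 ↔ rationalEvolution G ^ m = 1 := by
  rw [timeEvolution_eq_map, ← map_pow, ← map_one (algebraMap ℚ ℂ).mapMatrix]
  exact (Matrix.map_injective (algebraMap ℚ ℂ).injective).eq_iff

/-- The involutions `S` and `S * W` generate a dihedral group in which their product `W` has odd order,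
so they are conjugate and have equal traces. -/
theorem card_dart_eq_of_pow_eq_one (hpos : ∀ v, 0 < G.degree v) {k : ℕ} (hk : Odd k)
    (h : rationalEvolution G ^ k = 1) : Fintype.card G.Dart = 2 * Fintype.card V := by
  set S := arcReversal G ℚ with hS
  set K := terminusMatrix G ℚ with hK
  set B := averagingMatrix G with hB
  set W := rationalEvolution G with hW
  have hSS : S * S = 1 := arcReversal_mul_self G ℚ
  have hBK : B * Kᵀ = 1 := averagingMatrix_mul_transpose G hpos
  have hC : S * W = (2 : ℚ) • (Kᵀ * B) - 1 := by
    rw [hW, rationalEvolution, Matrix.mul_sub, Matrix.mul_smul, ← Matrix.mul_assoc,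
      arcReversal_mul_originMatrix, ← hS, hSS]
  have hCC : (S * W) * (S * W) = 1 := by
    have h4 : Kᵀ * B * (Kᵀ * B) = Kᵀ * B := by
      rw [Matrix.mul_assoc, ← Matrix.mul_assoc B, hBK, Matrix.one_mul]
    rw [hC]
    simp only [two_smul, Matrix.mul_sub, Matrix.sub_mul, Matrix.mul_add, Matrix.add_mul, h4,
      Matrix.mul_one, Matrix.one_mul]
    abel
  have hWSW : W * S * W = S := by
    calc W * S * W = S * (S * W * (S * W)) := by
          simp only [Matrix.mul_assoc]
          rw [← Matrix.mul_assoc S S, hSS, Matrix.one_mul]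
      _ = S := by rw [hCC, Matrix.mul_one]
  have hpow : ∀ j, W ^ j * S * W ^ j = S := by
    intro j
    induction j with
    | zero => simp
    | succ j ih =>
      calc W ^ (j + 1) * S * W ^ (j + 1) = W ^ j * (W * S * W) * W ^ j := by
            rw [pow_succ W j]
            nth_rewrite 2 [← pow_succ]
            rw [pow_succ' W j]
            simp only [Matrix.mul_assoc]
        _ = S := by rw [hWSW, ih]
  obtain ⟨j, rfl⟩ := hk
  have htr : trace (S * W) = trace S := by
    have h3 : W ^ (j + 1) * W ^ j = 1 := by rw [← pow_add, ← h]; congr 1; omega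
    -- With `k = 2 j + 1`, this exhibits `S * W` as the conjugate of `S` by `W ^ j`, since
    -- `W ^ (j + 1)` is the inverse of `W ^ j`.
    have h4 : S * W = W ^ j * S * W ^ (j + 1) := by
      have h5 := hpow j
      calc S * W = W ^ j * S * W ^ j * W := by rw [h5]
        _ = _ := by rw [Matrix.mul_assoc (W ^ j * S), ← pow_succ]
    rw [h4, trace_mul_comm, ← Matrix.mul_assoc, h3, Matrix.one_mul]
  have hS0 : trace S = 0 := by
    refine Finset.sum_eq_zero fun e _ => ?_
    simp [hS, arcReversal, (SimpleGraph.Dart.symm_ne e).symm]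
  rw [hS0, hC, trace_sub, trace_smul, trace_mul_comm, hBK, trace_one, trace_one] at htr
  have : (2 * Fintype.card V : ℚ) = Fintype.card G.Dart := by
    rw [smul_eq_mul] at htr
    linarith
  exact_mod_cast this.symm

/-- Conjugation by the signs of an orientation of the edges turns the arc reversal `S` into `-S`, and
`(z + S) * (z - S) = z² - 1`. -/
theorem det_smul_one_add_arcReversal_sq {R : Type*} [CommRing R] (z : R) :
    (z • 1 + arcReversal G R).det ^ 2 = (z ^ 2 - 1) ^ Fintype.card G.Dart := by
  classical
  -- Any linear order on the vertices orients the edges.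
  let _ : LinearOrder V := linearOrderOfSTO WellOrderingRel
  let s : G.Dart → R := fun e => if e.fst < e.snd then 1 else -1
  have hs : ∀ e, s e * s e = 1 := fun e => by
    simp only [s]; split_ifs <;> simp
  have hs' : ∀ e : G.Dart, s e.symm = - s e := fun e => by
    simp only [s, SimpleGraph.Dart.symm_toProd, Prod.fst_swap, Prod.snd_swap]
    rcases lt_or_gt_of_ne e.fst_ne_snd with h | h
    · simp [h, h.not_gt]
    · simp [h, h.not_gt]
  have h1 : diagonal s * (z • 1 + arcReversal G R) * diagonal s = z • 1 - arcReversal G R := by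
    ext e f
    rw [mul_diagonal, diagonal_mul]
    by_cases hef : e = f
    · subst hef
      simp only [Matrix.add_apply, Matrix.sub_apply, Matrix.smul_apply, one_apply_eq, arcReversal,
        of_apply, (SimpleGraph.Dart.symm_ne e).symm, if_false]
      rw [mul_right_comm, hs]; simp
    · simp only [Matrix.add_apply, Matrix.sub_apply, Matrix.smul_apply, one_apply_ne hef,
        arcReversal, of_apply]
      split_ifs with h
      · subst h
        rw [hs', mul_right_comm, neg_mul, hs]; simp
      · simp
  have h2 : (diagonal s).det * (diagonal s).det = 1 := by
    rw [← det_mul, diagonal_mul_diagonal]; simp [hs]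
  have h3 : (z • 1 + arcReversal G R).det = (z • 1 - arcReversal G R).det := by
    rw [← h1, det_mul, det_mul]
    linear_combination -(z • 1 + arcReversal G R).det * h2
  have h4 : (z • 1 + arcReversal G R) * (z • 1 - arcReversal G R) =
      (z ^ 2 - 1) • (1 : Matrix G.Dart G.Dart R) := by
    simp only [Matrix.add_mul, Matrix.mul_sub, arcReversal_mul_self, Matrix.smul_mul,
      Matrix.mul_smul, Matrix.one_mul, Matrix.mul_one, smul_add, smul_smul, sub_smul, one_smul,
      pow_two]
    abel
  rw [pow_two]
  nth_rewrite 2 [h3]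
  rw [← det_mul, h4]
  simp

end Incidence

/-! ### The characteristic polynomial of the Grover walk -/

theorem sum_adjMatrix_col {V : Type*} [Fintype V] (G : SimpleGraph V) [DecidableRel G.Adj]
    (R : Type*) [CommRing R] (w : V) :
    ∑ v, G.adjMatrix R v w = G.degree w := by
  simp [SimpleGraph.adjMatrix_apply, G.adj_comm _ w,
    ← SimpleGraph.card_neighborFinset_eq_degree, SimpleGraph.neighborFinset_eq_filter]

section Determinants

variable {V : Type*} [Fintype V] [DecidableEq V] (G : SimpleGraph V) [DecidableRel G.Adj]

theorem sum_degMatrix_col (R : Type*) [CommRing R] (w : V) :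
    ∑ v, G.degMatrix R v w = G.degree w := by
  simp [SimpleGraph.degMatrix, diagonal_apply]

/-- The columns of `D + A` have sums `2 deg w`, which gives one factor `2`; after replacing a row by the
degrees, all rows still have even sums, by the handshaking lemma for that row, which gives another. -/
theorem four_dvd_det_signless [Nonempty V] : 4 ∣ (G.degMatrix ℤ + G.adjMatrix ℤ).det := by
  obtain ⟨v⟩ := ‹Nonempty V›
  set Q := G.degMatrix ℤ + G.adjMatrix ℤ with hQ
  have hcol : ∀ w, ∑ u, Q u w = 2 * G.degree w := fun w => by
    simp only [hQ, Matrix.add_apply, Finset.sum_add_distrib, sum_adjMatrix_col, sum_degMatrix_col]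
    ring
  have hsymm : ∀ u w, Q u w = Q w u := fun u w => by
    have : Qᵀ = Q := by
      rw [hQ, transpose_add, G.transpose_adjMatrix, (SimpleGraph.isSymm_degMatrix ℤ G).eq]
    conv_lhs => rw [← this]
    rfl
  set N := Q.updateRow v (fun w => (G.degree w : ℤ)) with hN
  have h1 : Q.det = 2 * N.det := det_eq_mul_det_updateRow Q v 2 _ hcol
  have h2 : 2 ∣ N.det := by
    have hc : ∀ u, (2 : ℤ) ∣ ∑ w, Nᵀ w u := fun u => by
      simp only [transpose_apply]
      rcases eq_or_ne u v with rfl | hu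
      · refine ⟨G.edgeFinset.card, ?_⟩
        simp only [hN, updateRow_self]
        exact_mod_cast G.sum_degrees_eq_twice_card_edges
      · refine ⟨G.degree u, ?_⟩
        simp only [hN, updateRow_ne hu]
        rw [← hcol u]
        exact Finset.sum_congr rfl fun w _ => hsymm _ _
    choose c hc using hc
    rw [← det_transpose]
    exact ⟨_, det_eq_mul_det_updateRow Nᵀ v 2 c hc⟩
  obtain ⟨c, hc⟩ := h2
  exact ⟨c, by rw [h1, hc]; ring⟩

/-- A kernel vector is annihilated by all rows of the Laplacian (they add up to zero), hence constant,
and the row of degrees forces the constant to be zero. -/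
theorem det_lapMatrix_updateRow_ne_zero (hG : G.Connected) (hpos : ∀ v, 0 < G.degree v) (v : V) :
    ((G.lapMatrix ℚ).updateRow v fun w => (G.degree w : ℚ)).det ≠ 0 := by
  intro h0
  obtain ⟨x, hx0, hx⟩ := exists_mulVec_eq_zero_iff.2 h0
  have hrow : ∀ u, u ≠ v → (G.lapMatrix ℚ *ᵥ x) u = 0 := fun u hu => by
    have := congrFun hx u
    simpa only [mulVec, updateRow_ne hu, Pi.zero_apply] using this
  have hdeg : ∑ w, (G.degree w : ℚ) * x w = 0 := by
    have := congrFun hx v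
    simpa only [mulVec, updateRow_self, Pi.zero_apply, dotProduct] using this
  have hsum : ∑ u, (G.lapMatrix ℚ *ᵥ x) u = 0 := by
    have h1 : (fun _ => (1 : ℚ)) ᵥ* G.lapMatrix ℚ = 0 := by
      rw [← mulVec_transpose, (SimpleGraph.isSymm_lapMatrix ℚ G).eq]
      exact SimpleGraph.lapMatrix_mulVec_const_eq_zero (R := ℚ) G
    have h2 := dotProduct_mulVec (fun _ => (1 : ℚ)) (G.lapMatrix ℚ) x
    rw [h1, zero_dotProduct] at h2
    simpa [dotProduct] using h2
  have hLx : G.lapMatrix ℚ *ᵥ x = 0 := by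
    ext u
    rcases eq_or_ne u v with rfl | hu
    · rw [Finset.sum_eq_single u (fun w _ hw => hrow w hw) (by simp)] at hsum
      exact hsum
    · exact hrow u hu
  have hconst : ∀ i j, x i = x j := by
    have h3 : Matrix.toLinearMap₂' ℚ (G.lapMatrix ℚ) x x = 0 := by
      rw [toLinearMap₂'_apply', hLx, dotProduct_zero]
    have h4 := (SimpleGraph.lapMatrix_toLinearMap₂'_apply'_eq_zero_iff_forall_adj ℚ G x).1 h3
    intro i j
    obtain ⟨p⟩ := hG.preconnected i j
    induction p with
    | nil => rfl
    | cons hadj _ ih => exact (h4 _ _ hadj).trans ih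
  have h5 : (∑ w, (G.degree w : ℚ)) * x v = 0 := by
    rw [Finset.sum_mul, ← hdeg]
    exact Finset.sum_congr rfl fun w _ => by rw [hconst v w]
  have h6 : 0 < ∑ w, (G.degree w : ℚ) :=
    Finset.sum_pos (fun w _ => Nat.cast_pos.2 (hpos w)) ⟨v, Finset.mem_univ v⟩
  have h7 : x v = 0 := (mul_eq_zero.1 h5).resolve_left h6.ne'
  exact hx0 (funext fun w => (hconst w v).trans h7)

/-- The polynomial matrix `(X² + 1) D - 2 X A`. -/
noncomputable def spectralMatrix : Matrix V V ℚ[X] :=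
  (X ^ 2 + 1 : ℚ[X]) • G.degMatrix ℚ[X] - (2 * X : ℚ[X]) • G.adjMatrix ℚ[X]

theorem det_charpoly_eq (hcard : Fintype.card G.Dart = 2 * Fintype.card V) :
    (G.degMatrix ℚ[X]).det * (rationalEvolution G).charpoly = (spectralMatrix G).det := by
  have hB : G.degMatrix ℚ[X] * (averagingMatrix G).map (C : ℚ →+* ℚ[X]) = terminusMatrix G ℚ[X] := by
    have h := congrArg (fun M : Matrix V G.Dart ℚ => M.map (C : ℚ →+* ℚ[X]))
      (degMatrix_mul_averagingMatrix G)
    simp only [Matrix.map_mul] at h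
    convert h using 2
    · ext1 u v
      simp [SimpleGraph.degMatrix, diagonal_apply, apply_ite C]
    · ext1 u v
      simp [terminusMatrix, apply_ite C]
  have h := det_mul_det_sub_mul_mul_pow (X : ℚ[X]) (arcReversal G ℚ[X]) (arcReversal_mul_self G _)
    ((2 : ℚ[X]) • originMatrix G ℚ[X]) _ _ _ hB
  have h1 : (X : ℚ[X]) • 1 + arcReversal G ℚ[X] - (2 : ℚ[X]) • originMatrix G ℚ[X] *
      (averagingMatrix G).map (C : ℚ →+* ℚ[X]) = charmatrix (rationalEvolution G) := by
    have hO : originMatrix G ℚ[X] = (originMatrix G ℚ).map C := by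
      ext1 e v
      simp [originMatrix, apply_ite C]
    have hS : arcReversal G ℚ[X] = (arcReversal G ℚ).map C := by
      ext1 e f
      simp [arcReversal, apply_ite C]
    rw [hO, hS, Matrix.smul_mul, ← Matrix.map_mul, charmatrix, rationalEvolution]
    ext1 e f
    simp [Matrix.one_apply, diagonal_apply, -Matrix.map_mul, map_ofNat C 2]
    ring
  have h2 : (X ^ 2 - 1 : ℚ[X]) • G.degMatrix ℚ[X] - terminusMatrix G ℚ[X] *
      ((X : ℚ[X]) • 1 - arcReversal G ℚ[X]) * ((2 : ℚ[X]) • originMatrix G ℚ[X]) =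
      spectralMatrix G := by
    rw [spectralMatrix, Matrix.mul_assoc, Matrix.sub_mul]
    simp only [Matrix.mul_smul, Matrix.smul_mul, Matrix.mul_sub, Matrix.one_mul,
      arcReversal_mul_originMatrix, terminusMatrix_mul_transpose, terminusMatrix_mul_originMatrix]
    module
  have h3 : ((X : ℚ[X]) • 1 + arcReversal G ℚ[X]).det = (X ^ 2 - 1) ^ Fintype.card V := by
    have hsq := det_smul_one_add_arcReversal_sq G (X : ℚ[X])
    rw [hcard, mul_comm 2, pow_mul, sq_eq_sq_iff_eq_or_eq_neg] at hsq
    -- Both sides are monic, which fixes the sign of the square root.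
    refine hsq.resolve_right fun hneg => ?_
    have hm1 : ((X : ℚ[X]) • 1 + arcReversal G ℚ[X]).det.Monic := by
      have : (X : ℚ[X]) • 1 + arcReversal G ℚ[X] = charmatrix (-arcReversal G ℚ) := by
        ext1 e f
        simp [charmatrix, arcReversal, Matrix.one_apply, diagonal_apply, apply_ite C]
      rw [this]
      exact charpoly_monic _
    have hm2 : ((X ^ 2 - 1 : ℚ[X]) ^ Fintype.card V).Monic :=
      (by simpa using monic_X_pow_sub_C (1 : ℚ) two_ne_zero : (X ^ 2 - 1 : ℚ[X]).Monic).pow _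
    have := hm1.leadingCoeff
    rw [hneg, leadingCoeff_neg, hm2.leadingCoeff] at this
    norm_num at this
  rw [h1, h2, h3] at h
  have hne : (X ^ 2 - 1 : ℚ[X]) ^ Fintype.card V ≠ 0 :=
    pow_ne_zero _ (X_pow_sub_C_ne_zero two_pos (1 : ℚ))
  refine mul_right_cancel₀ hne ?_
  rw [Matrix.charpoly, h, mul_comm]

theorem det_spectralMatrix_eq (v : V) : (spectralMatrix G).det =
    (X - 1) ^ 2 * ((spectralMatrix G).updateRow v fun w => (G.degree w : ℚ[X])).det := by
  refine det_eq_mul_det_updateRow _ v _ _ fun w => ?_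
  simp only [spectralMatrix, Matrix.sub_apply, Matrix.smul_apply, Finset.sum_sub_distrib,
    ← Finset.mul_sum, sum_adjMatrix_col, sum_degMatrix_col, smul_eq_mul]
  ring

theorem rootMultiplicity_charpoly_le (hG : G.Connected) (hpos : ∀ v, 0 < G.degree v)
    (hcard : Fintype.card G.Dart = 2 * Fintype.card V) :
    (rationalEvolution G).charpoly.rootMultiplicity 1 ≤ 2 := by
  obtain ⟨v⟩ := hG.nonempty
  by_contra! hlt
  have h3 : (X - C 1 : ℚ[X]) ^ 3 ∣ (rationalEvolution G).charpoly :=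
    (pow_dvd_pow _ hlt).trans (pow_rootMultiplicity_dvd _ _)
  have h4 := h3.trans (Dvd.intro_left _ (det_charpoly_eq G hcard))
  rw [det_spectralMatrix_eq G v, C_1, pow_succ] at h4
  have h5 := (mul_dvd_mul_iff_left (pow_ne_zero 2 (X_sub_C_ne_zero (1 : ℚ)))).1 (by simpa using h4)
  have h6 := dvd_iff_isRoot.1 h5
  have hmap : (evalRingHom (1 : ℚ)).mapMatrix
      ((spectralMatrix G).updateRow v fun w => (G.degree w : ℚ[X])) =
      ((2 : ℚ) • G.lapMatrix ℚ).updateRow v fun w => (G.degree w : ℚ) := by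
    ext u w
    rcases eq_or_ne u v with rfl | hu
    · simp
    · simp only [RingHom.mapMatrix_apply, map_apply, updateRow_ne hu, spectralMatrix,
        SimpleGraph.lapMatrix, SimpleGraph.degMatrix, diagonal_apply, SimpleGraph.adjMatrix_apply,
        Matrix.sub_apply, Matrix.smul_apply, coe_evalRingHom, smul_eq_mul, eval_sub, eval_mul,
        eval_add, eval_pow, eval_X, eval_one, eval_ofNat]
      split_ifs <;> simp <;> first | done | norm_num <;> ring_nf
  have h7 := (evalRingHom (1 : ℚ)).map_det
    ((spectralMatrix G).updateRow v fun w => (G.degree w : ℚ[X]))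
  rw [hmap, det_updateRow_smul_left] at h7
  rw [IsRoot, ← coe_evalRingHom, h7] at h6
  exact mul_ne_zero (by positivity) (det_lapMatrix_updateRow_ne_zero G hG hpos v) h6

/-- Evaluation of `det_charpoly_eq` at `-1`. -/
theorem prod_degree_mul_eval_charpoly (hcard : Fintype.card G.Dart = 2 * Fintype.card V) :
    (∏ v, (G.degree v : ℚ)) * (rationalEvolution G).charpoly.eval (-1) =
      2 ^ Fintype.card V * (((G.degMatrix ℤ + G.adjMatrix ℤ).det : ℤ) : ℚ) := by
  have h := congrArg (evalRingHom (-1 : ℚ)) (det_charpoly_eq G hcard)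
  have hmap : (evalRingHom (-1 : ℚ)).mapMatrix (spectralMatrix G) =
      (2 : ℚ) • (Int.castRingHom ℚ).mapMatrix (G.degMatrix ℤ + G.adjMatrix ℤ) := by
    ext u w
    simp only [RingHom.mapMatrix_apply, map_apply, spectralMatrix,
        SimpleGraph.degMatrix, diagonal_apply, SimpleGraph.adjMatrix_apply, Matrix.add_apply,
        Matrix.sub_apply, Matrix.smul_apply, coe_evalRingHom, smul_eq_mul, eval_sub, eval_mul,
        eval_add, eval_pow, eval_X, eval_one, eval_ofNat]
    split_ifs <;> simp <;> first | done | norm_num <;> ring_nf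
  rw [map_mul, RingHom.map_det _ (spectralMatrix G), hmap, det_smul, ← RingHom.map_det] at h
  simpa [SimpleGraph.degMatrix, det_diagonal, eval_prod] using h

theorem degree_eq_two_of_pow_eq_one (hG : G.Connected) (hpos : ∀ v, 0 < G.degree v) {k : ℕ}
    (hk : Odd k) (h : timeEvolution G ^ k = 1) (v : V) : G.degree v = 2 := by
  have : Nonempty V := ⟨v⟩
  rw [timeEvolution_pow_eq_one_iff] at h
  have hcard := card_dart_eq_of_pow_eq_one G hpos hk h
  obtain ⟨p, hp, hdvd⟩ := exists_int_charpoly_dvd _ hk.pos.ne' h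
  have hm : p.rootMultiplicity 1 ≤ 2 := by
    rw [eq_rootMultiplicity_map (f := Int.castRingHom ℚ) Int.cast_injective, map_one, hp]
    exact rootMultiplicity_charpoly_le G hG hpos hcard
  have habs := abs_eval_neg_one_of_dvd hk hdvd
  have hev : (rationalEvolution G).charpoly.eval (-1) = ((p.eval (-1) : ℤ) : ℚ) := by
    rw [← hp]
    simpa using eval_intCast_map (Int.castRingHom ℚ) p (-1)
  have hmain : (∏ v, (G.degree v : ℤ)) * p.eval (-1) =
      2 ^ Fintype.card V * (G.degMatrix ℤ + G.adjMatrix ℤ).det := by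
    have h1 := prod_degree_mul_eval_charpoly G hcard
    rw [hev] at h1
    exact_mod_cast h1
  refine all_eq_two_of_prod (fun v => G.degree v) hpos
    (by rw [← G.dart_card_eq_sum_degrees, hcard]) ?_ v
  obtain ⟨c, hc⟩ := four_dvd_det_signless G
  have hP : 0 < ∏ v, (G.degree v : ℤ) :=
    Finset.prod_pos fun w _ => Int.natCast_pos.2 (hpos w)
  have hmain2 := congrArg abs hmain
  rw [hc, abs_mul, abs_mul, abs_mul, habs, abs_of_pos hP] at hmain2
  have hc0 : 0 < |c| := by
    rw [abs_pos]
    rintro rfl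
    simp only [abs_zero, mul_zero] at hmain2
    have : 0 < (∏ v, (G.degree v : ℤ)) * 2 ^ p.rootMultiplicity 1 := by positivity
    omega
  have hm4 : (2 : ℤ) ^ p.rootMultiplicity 1 ≤ 4 :=
    (pow_le_pow_right₀ (by norm_num) hm).trans (by norm_num)
  have h2n : |(2 : ℤ) ^ Fintype.card V| = 2 ^ Fintype.card V := abs_of_pos (by positivity)
  rw [h2n] at hmain2
  have h2pos : (0 : ℤ) < 2 ^ Fintype.card V := by positivity
  have : (2 : ℤ) ^ Fintype.card V ≤ ∏ v, (G.degree v : ℤ) := by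
    have e1 : (∏ v, (G.degree v : ℤ)) * 2 ^ p.rootMultiplicity 1 ≤
        (∏ v, (G.degree v : ℤ)) * 4 := mul_le_mul_of_nonneg_left hm4 hP.le
    have e2 : (2 : ℤ) ^ Fintype.card V * (4 * 1) ≤ 2 ^ Fintype.card V * (|4| * |c|) := by
      refine mul_le_mul_of_nonneg_left ?_ h2pos.le
      rw [abs_of_pos (by norm_num : (0 : ℤ) < 4)]
      omega
    omega
  exact_mod_cast this

end Determinants

end Spectrum

/-! ### Connected graphs with all degrees two -/

/-- A walk that never turns back visits distinct vertices until it first repeats one; as all degrees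
are two, that repetition closes the walk up at its start, and the vertices visited are closed under
adjacency. -/
theorem nonempty_iso_cycleGraph {V : Type*} [Fintype V] [DecidableEq V] (G : SimpleGraph V)
    [DecidableRel G.Adj] (hG : G.Connected) (hdeg : ∀ v, G.degree v = 2) :
    Nonempty (G ≃g SimpleGraph.cycleGraph (Fintype.card V)) := by
  classical
  have hnb : ∀ {u a b c : V}, G.Adj u a → G.Adj u b → a ≠ b → G.Adj u c → c = a ∨ c = b := by
    intro u a b c ha hb hab hc
    by_contra! hcon
    have h3 : ({a, b, c} : Finset V).card = 3 := by
      rw [Finset.card_eq_three]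
      exact ⟨a, b, c, hab, hcon.1.symm, hcon.2.symm, rfl⟩
    have hsub : ({a, b, c} : Finset V) ⊆ G.neighborFinset u := by
      intro x hx
      simp only [Finset.mem_insert, Finset.mem_singleton] at hx
      rw [SimpleGraph.mem_neighborFinset]
      rcases hx with rfl | rfl | rfl <;> assumption
    have := Finset.card_le_card hsub
    rw [h3, SimpleGraph.card_neighborFinset_eq_degree, hdeg] at this
    omega
  have hnext : ∀ e : G.Dart, ∃ e' : G.Dart, e'.fst = e.snd ∧ e'.snd ≠ e.fst := by
    intro e
    have : 1 < (G.neighborFinset e.snd).card := by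
      rw [SimpleGraph.card_neighborFinset_eq_degree, hdeg]; norm_num
    obtain ⟨w, hw, hne⟩ := Finset.exists_mem_ne this e.fst
    exact ⟨⟨(e.snd, w), (G.mem_neighborFinset _ _).1 hw⟩, rfl, hne⟩
  choose next hnext1 hnext2 using hnext
  obtain ⟨v0⟩ := hG.nonempty
  obtain ⟨w0, hw0⟩ := (G.degree_pos_iff_exists_adj v0).1 (by rw [hdeg]; norm_num)
  -- `x i` is the `i`-th vertex of a walk that never turns back.
  let d : ℕ → G.Dart := fun i => next^[i] ⟨(v0, w0), hw0⟩
  have hd : ∀ i, d (i + 1) = next (d i) := fun i => Function.iterate_succ_apply' next i _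
  let x : ℕ → V := fun i => (d i).fst
  have hx1 : ∀ i, (d i).snd = x (i + 1) := fun i => by
    simp only [x, hd, hnext1]
  have hadj : ∀ i, G.Adj (x i) (x (i + 1)) := fun i => by
    rw [← hx1]; exact (d i).adj
  have hne : ∀ i, x (i + 2) ≠ x i := fun i => by
    have := hnext2 (d i)
    rwa [← hd, hx1] at this
  -- `n` is the first time at which a vertex is visited again, and that vertex is `x i`.
  have hrep : ∃ j, ∃ i < j, x i = x j := by
    obtain ⟨a, b, hab, h⟩ := Finite.exists_ne_map_eq_of_infinite x
    rcases lt_or_gt_of_ne hab with h' | h'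
    · exact ⟨b, a, h', h⟩
    · exact ⟨a, b, h', h.symm⟩
  let n := Nat.find hrep
  obtain ⟨i, hi, hin⟩ : ∃ i < n, x i = x n := Nat.find_spec hrep
  have hinj : ∀ a b, a < n → b < n → x a = x b → a = b := by
    intro a b ha hb h
    rcases lt_trichotomy a b with h' | h' | h'
    · exact (Nat.find_min hrep hb ⟨a, h', h⟩).elim
    · exact h'
    · exact (Nat.find_min hrep ha ⟨b, h', h.symm⟩).elim
  have hn3 : i + 3 ≤ n := by
    rcases Nat.lt_or_ge n (i + 3) with h | h
    · obtain h' | h' : n = i + 1 ∨ n = i + 2 := by omega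
      · rw [h'] at hin
        exact ((hadj i).ne hin).elim
      · rw [h'] at hin
        exact (hne i hin.symm).elim
    · exact h
  -- If `i > 0`, the vertex preceding `x n` would be a neighbour of `x i`, hence `x (i - 1)` or
  -- `x (i + 1)`, a repetition before time `n`.
  have hi0 : i = 0 := by
    by_contra hi0
    obtain ⟨i', rfl⟩ := Nat.exists_eq_succ_of_ne_zero hi0
    obtain ⟨n', hn'⟩ : ∃ n', n = n' + 1 := ⟨n - 1, by omega⟩
    have h1 : G.Adj (x (i' + 1)) (x n') := by
      have := hadj n'
      rw [← hn', ← hin] at this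
      exact this.symm
    rcases hnb (hadj i').symm (hadj (i' + 1)) (hne i').symm h1 with h | h
    · have := hinj _ _ (by omega) (by omega) h
      omega
    · have := hinj _ _ (by omega) (by omega) h
      omega
  subst hi0
  obtain ⟨m, hm⟩ : ∃ m, n = m + 3 := ⟨n - 3, by omega⟩
  rw [hm] at hin hinj
  have hclosed : ∀ a, a < m + 3 → ∀ w, G.Adj (x a) w → ∃ b, b < m + 3 ∧ x b = w := by
    intro a ha w hw
    rcases Nat.eq_zero_or_pos a with rfl | hpos
    · have h1 : G.Adj (x 0) (x (m + 2)) := by rw [hin]; exact (hadj (m + 2)).symm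
      have h2 : x 1 ≠ x (m + 2) := fun h => by
        have := hinj _ _ (by omega) (by omega) h
        omega
      rcases hnb (hadj 0) h1 h2 hw with h | h
      · exact ⟨1, by omega, h.symm⟩
      · exact ⟨m + 2, by omega, h.symm⟩
    · obtain ⟨a', rfl⟩ := Nat.exists_eq_succ_of_ne_zero hpos.ne'
      rcases hnb (hadj a').symm (hadj (a' + 1)) (hne a').symm hw with h | h
      · exact ⟨a', by omega, h.symm⟩
      · rcases Nat.lt_or_ge (a' + 2) (m + 3) with h' | h'
        · exact ⟨a' + 2, h', h.symm⟩
        · refine ⟨0, by omega, ?_⟩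
          rw [hin, h, show m + 3 = a' + 1 + 1 by omega]
  have hsurj : ∀ v, ∃ b, b < m + 3 ∧ x b = v := by
    intro v
    obtain ⟨p⟩ := hG.preconnected v (x 0)
    have key : ∀ {u w : V} (_ : G.Walk u w), (∃ b, b < m + 3 ∧ x b = w) →
        ∃ b, b < m + 3 ∧ x b = u := by
      intro u w p
      induction p with
      | nil => exact id
      | cons h _ ih =>
        intro hw
        obtain ⟨b, hb, rfl⟩ := ih hw
        exact hclosed b hb _ h.symm
    exact key p ⟨0, by omega, rfl⟩
  let f : Fin (m + 3) → V := fun a => x a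
  have hbij : Function.Bijective f := by
    refine ⟨fun a b h => Fin.ext (hinj _ _ a.2 b.2 h), fun v => ?_⟩
    obtain ⟨b, hb, h⟩ := hsurj v
    exact ⟨⟨b, hb⟩, h⟩
  have hcard : Fintype.card V = m + 3 := by
    rw [← Fintype.card_of_bijective hbij, Fintype.card_fin]
  have hstep : ∀ a : Fin (m + 3), G.Adj (f a) (f (a + 1)) := by
    intro a
    have ha : f (a + 1) = x (a + 1) := by
      simp only [f, Fin.val_add_one]
      split_ifs with h
      · rw [h, Fin.val_last, hin]
      · rfl
    rw [ha]
    exact hadj a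
  have hhom : ∀ a b, (SimpleGraph.cycleGraph (m + 3)).Adj a b → G.Adj (f a) (f b) := by
    intro a b hab
    rcases SimpleGraph.cycleGraph_adj.1 hab with h | h
    · rw [sub_eq_iff_eq_add'.1 h]
      exact (hstep b).symm
    · rw [sub_eq_iff_eq_add'.1 h]
      exact hstep a
  -- Both graphs are 2-regular, so a bijective homomorphism reflects adjacency.
  have himg : ∀ a, ((SimpleGraph.cycleGraph (m + 3)).neighborFinset a).image f =
      G.neighborFinset (f a) := by
    intro a
    refine Finset.eq_of_subset_of_card_le ?_ ?_
    · intro y hy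
      obtain ⟨b, hb, rfl⟩ := Finset.mem_image.1 hy
      exact (G.mem_neighborFinset _ _).2 (hhom a b ((SimpleGraph.mem_neighborFinset _ _ _).1 hb))
    · rw [Finset.card_image_of_injective _ hbij.1, SimpleGraph.card_neighborFinset_eq_degree,
        SimpleGraph.card_neighborFinset_eq_degree, hdeg, SimpleGraph.cycleGraph_degree_three_le]
  rw [hcard]
  refine ⟨SimpleGraph.Iso.symm ⟨Equiv.ofBijective f hbij, ?_⟩⟩
  intro a b
  refine ⟨fun h => ?_, hhom a b⟩
  have h1 : f b ∈ ((SimpleGraph.cycleGraph (m + 3)).neighborFinset a).image f := by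
    rw [himg, SimpleGraph.mem_neighborFinset]
    exact h
  obtain ⟨c, hc, hcb⟩ := Finset.mem_image.1 h1
  rw [← hbij.1 hcb]
  exact (SimpleGraph.mem_neighborFinset _ _ _).1 hc

/-! ### Periods of the walk on cycles -/

section Transfer

variable {V W : Type*} [Fintype V] [DecidableEq V] [Fintype W] [DecidableEq W]
  {G : SimpleGraph V} [DecidableRel G.Adj] {H : SimpleGraph W} [DecidableRel H.Adj]

/-- The bijection on arcs induced by a graph isomorphism. -/
def dartEquiv (φ : G ≃g H) : G.Dart ≃ H.Dart where
  toFun e := φ.toHom.mapDart e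
  invFun e := φ.symm.toHom.mapDart e
  left_inv e := by ext <;> simp
  right_inv e := by ext <;> simp

theorem timeEvolution_reindex (φ : G ≃g H) :
    Matrix.reindexAlgEquiv ℂ ℂ (dartEquiv φ) (timeEvolution G) = timeEvolution H := by
  ext e f
  obtain ⟨e, rfl⟩ := (dartEquiv φ).surjective e
  obtain ⟨f, rfl⟩ := (dartEquiv φ).surjective f
  have hsymm : (dartEquiv φ f).symm = dartEquiv φ f.symm := by
    ext <;> rfl
  have h1 : (dartEquiv φ f).snd = φ f.snd := rfl
  have h2 : (dartEquiv φ e).fst = φ e.fst := rfl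
  have h3 : H.degree (dartEquiv φ f).snd = G.degree f.snd := φ.degree_eq f.snd
  simp only [Matrix.coe_reindexAlgEquiv, Matrix.reindex_apply, Matrix.submatrix_apply,
    Equiv.symm_apply_apply, timeEvolution, Matrix.of_apply, hsymm, h3, h1, h2, ne_eq,
    EmbeddingLike.apply_eq_iff_eq]

theorem isKPeriodic_congr (φ : G ≃g H) (k : ℕ) : IsKPeriodic G k ↔ IsKPeriodic H k := by
  have h : ∀ m, timeEvolution G ^ m = 1 ↔ timeEvolution H ^ m = 1 := fun m => by
    rw [← timeEvolution_reindex φ, ← map_pow, EmbeddingLike.map_eq_one_iff]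
  simp only [IsKPeriodic, h]

end Transfer

theorem isKPeriodic_one_of_subsingleton {V : Type*} [Fintype V] [DecidableEq V] [Subsingleton V]
    (G : SimpleGraph V) [DecidableRel G.Adj] : IsKPeriodic G 1 := by
  have : IsEmpty G.Dart := ⟨fun e => e.fst_ne_snd (Subsingleton.elim _ _)⟩
  exact ⟨⟨one_pos, Subsingleton.elim _ _⟩, fun m hm => hm.1⟩

section Cycle

open SimpleGraph
open scoped Fin.CommRing

variable {n : ℕ}

/-- The arc of the cycle obtained from `e` by moving `m` steps in its own direction: `e.snd - e.fst` is
`1` or `-1`, and `m` times it is added to both ends. -/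
def shiftDart (m : Fin (n + 3)) (e : (cycleGraph (n + 3)).Dart) : (cycleGraph (n + 3)).Dart :=
  ⟨(e.fst + m * (e.snd - e.fst), e.snd + m * (e.snd - e.fst)), by
    have := e.adj
    rw [cycleGraph_adj] at this ⊢
    simpa using this⟩

theorem timeEvolution_cycleGraph_apply (e f : (cycleGraph (n + 3)).Dart) :
    timeEvolution (cycleGraph (n + 3)) e f = if e = shiftDart 1 f then 1 else 0 := by
  have hdeg : (cycleGraph (n + 3)).degree f.snd = 2 := cycleGraph_degree_three_le
  have key : f.snd = e.fst ∧ e ≠ f.symm ↔ e = shiftDart 1 f := by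
    -- With at least three vertices, the two directions `1` and `-1` differ.
    have two_ne : (1 : Fin (n + 3)) + 1 ≠ 0 := by
      simp [Fin.ext_iff, Fin.val_add, Nat.mod_eq_of_lt (show 2 < n + 3 by omega)]
    obtain ⟨⟨a, b⟩, hab⟩ := e
    obtain ⟨⟨u, w⟩, huw⟩ := f
    have hab' := cycleGraph_adj.1 hab
    have huw' := cycleGraph_adj.1 huw
    simp only [shiftDart, Dart.symm_mk, Prod.swap_prod_mk, ne_eq, Dart.mk.injEq, Prod.mk.injEq,
      one_mul] at hab' huw' ⊢
    constructor
    · rintro ⟨rfl, h⟩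
      have hbu : b ≠ u := fun hb => h ⟨rfl, hb⟩
      refine ⟨by ring, ?_⟩
      rcases huw' with h1 | h1 <;> rcases hab' with h2 | h2
      · linear_combination h1 - h2
      · exact (hbu (by linear_combination h2 - h1)).elim
      · exact (hbu (by linear_combination h1 - h2)).elim
      · linear_combination h2 - h1
    · rintro ⟨rfl, rfl⟩
      refine ⟨by ring, ?_⟩
      rintro ⟨-, h⟩
      rcases huw' with h1 | h1
      · exact two_ne (by linear_combination -2 * h1 - h)
      · exact two_ne (by linear_combination h - 2 * h1)
  simp only [timeEvolution, Matrix.of_apply, key, hdeg]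
  split_ifs <;> norm_num

theorem timeEvolution_cycleGraph_pow_apply (m : ℕ) (e f : (cycleGraph (n + 3)).Dart) :
    (timeEvolution (cycleGraph (n + 3)) ^ m) e f = if e = shiftDart m f then 1 else 0 := by
  induction m generalizing e with
  | zero =>
    have : shiftDart ((0 : ℕ) : Fin (n + 3)) f = f := by
      ext <;> simp [shiftDart]
    rw [this, pow_zero, Matrix.one_apply]
  | succ m ih =>
    have : shiftDart ((m + 1 : ℕ) : Fin (n + 3)) f = shiftDart 1 (shiftDart m f) := by
      ext1
      simp only [shiftDart, Prod.mk.injEq, add_sub_add_right_eq_sub]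
      push_cast
      constructor <;> ring
    rw [pow_succ', Matrix.mul_apply, this]
    simp [ih, timeEvolution_cycleGraph_apply]

theorem isKPeriodic_cycleGraph : IsKPeriodic (cycleGraph (n + 3)) (n + 3) := by
  have key : ∀ m : ℕ, timeEvolution (cycleGraph (n + 3)) ^ m = 1 ↔ n + 3 ∣ m := by
    intro m
    rw [← Fin.natCast_eq_zero]
    constructor
    · intro h
      -- The arc `(0, 1)` returns to itself only after a full turn.
      let e : (cycleGraph (n + 3)).Dart := ⟨(0, 1), by simp [cycleGraph_adj]⟩
      have h1 := timeEvolution_cycleGraph_pow_apply m e e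
      rw [h, Matrix.one_apply_eq] at h1
      have h2 : e = shiftDart m e := by
        by_contra hne
        rw [if_neg hne] at h1
        exact one_ne_zero h1
      have h3 := congrArg (fun d => d.fst) h2
      simpa [shiftDart, e] using h3.symm
    · intro h
      ext e f
      rw [timeEvolution_cycleGraph_pow_apply, h, Matrix.one_apply]
      have : shiftDart 0 f = f := by ext <;> simp [shiftDart]
      rw [this]
  refine ⟨⟨by omega, (key _).2 dvd_rfl⟩, fun m hm => Nat.le_of_dvd hm.1 ((key m).1 hm.2)⟩

theorem isKPeriodic_cycleGraph_of_odd {k : ℕ} (hk : Odd k) : IsKPeriodic (cycleGraph k) k := by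
  obtain ⟨_ | j, rfl⟩ := hk
  · exact isKPeriodic_one_of_subsingleton (cycleGraph 1)
  · exact isKPeriodic_cycleGraph (n := 2 * j)

end Cycle

/-! ### Odd-periodic graphs -/

theorem nonempty_iso_cycleGraph_of_isKPeriodic {V : Type*} [Fintype V] [DecidableEq V]
    (G : SimpleGraph V) [DecidableRel G.Adj] (hG : G.Connected) {k : ℕ} (hk : Odd k)
    (h : IsKPeriodic G k) : Nonempty (G ≃g SimpleGraph.cycleGraph k) := by
  rcases subsingleton_or_nontrivial V with hV | hV
  · obtain rfl : k = 1 := h.unique (isKPeriodic_one_of_subsingleton G)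
    obtain ⟨v⟩ := hG.nonempty
    let φ : V ≃ Fin 1 := Fintype.equivFinOfCardEq
      (Fintype.card_eq_one_iff.2 ⟨v, fun _ => Subsingleton.elim _ _⟩)
    refine ⟨⟨φ, ?_⟩⟩
    intro a b
    rw [Subsingleton.elim a b]
    simp
  · have hdeg := degree_eq_two_of_pow_eq_one G hG
      (fun v => hG.preconnected.degree_pos_of_nontrivial v) hk h.1.2
    obtain ⟨φ⟩ := nonempty_iso_cycleGraph G hG hdeg
    obtain ⟨v⟩ := hG.nonempty
    have hlt := G.degree_lt_card_verts v
    rw [hdeg] at hlt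
    obtain ⟨n, hn⟩ : ∃ n, Fintype.card V = n + 3 := ⟨Fintype.card V - 3, by omega⟩
    rw [hn] at φ
    obtain rfl : k = n + 3 := h.unique ((isKPeriodic_congr φ _).2 isKPeriodic_cycleGraph)
    exact ⟨φ⟩

end GroverWalk

theorem theorem2p5 {V : Type*} [Fintype V] [DecidableEq V] (G : SimpleGraph V)
    [DecidableRel G.Adj] (hG : G.Connected) :
    (∀ k : ℕ, Odd k →
      (GroverWalk.IsKPeriodic G k ↔ Nonempty (G ≃g SimpleGraph.cycleGraph k))) ∧
    ((∃ k : ℕ, Odd k ∧ GroverWalk.IsKPeriodic G k) ↔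
      ∃ k : ℕ, Odd k ∧ Nonempty (G ≃g SimpleGraph.cycleGraph k)) := by
  have key : ∀ k : ℕ, Odd k →
      (GroverWalk.IsKPeriodic G k ↔ Nonempty (G ≃g SimpleGraph.cycleGraph k)) := fun k hk =>
    ⟨GroverWalk.nonempty_iso_cycleGraph_of_isKPeriodic G hG hk, fun ⟨φ⟩ =>
      (GroverWalk.isKPeriodic_congr φ k).2 (GroverWalk.isKPeriodic_cycleGraph_of_odd hk)⟩
  exact ⟨key, exists_congr fun k => and_congr_right (key k)⟩
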